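/- Fix a field and let $H_k$ denote reduced simplicial homology with coefficients in it, $k\ge 0$. A *filtration* $\mathcal F$ is a finite abstract simplicial complex with a real value $w(s)$ for each simplex $s$, such that $w(t)\le w(s)$ whenever $t$ is a face of $s$ and distinct simplices have distinct values. Let $X_t$ and $X_{<t}$ be the subcomplexes of the simplices with value $\le t$ and $<t$. An interval decomposition $\mathrm{PH}_k(\mathcal F)\cong\bigoplus_{i} \mathbb I[b_i,d_i)$ of the persistence module $\{H_k(X_t)\}_{t\in\mathbb R}$, with $b_i\in\mathbb R$, $d_i\in\mathbb R\cup\{\infty\}$, $b_i<d_i$, gives the points $(b_i,d_i)$ of the persistence diagram $\mathrm{dgm}_k(\mathcal F)$; let $\gamma_i\in H_k(X_{b_i})$ be the class that generates the $i$-th summand. A simplex $\tau$ of $\mathcal F$ *kills* a class $\gamma\in H_k(X_b)$ if $w(\tau)>b$ and, writing $t=w(\tau)$, the image of $\gamma$ in $H_k(X_{<t})$ is not in the image of $H_k(X_{<b})$, but the image of $\gamma$ in $H_k(X_t)$ is in the image of $H_k(X_{<b})$ (elder rule). At most one simplex kills $\gamma$; it is denoted by $\phi_{\mathcal F}(\gamma)$,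 and $\phi_{\mathcal F}(\gamma)=\varnothing$ if there is none. A simplex $\sigma$ of dimension $\ell\ge1$ is *negative* in $\mathcal F$ if the map $H_{\ell-1}(X_{<w(\sigma)})\to H_{\ell-1}(X_{w(\sigma)})$ is not injective. Let $\mathcal F'$ be a filtration obtained from the filtration $\mathcal F$ by inserting one new simplex $\sigma$ (at the time $w(\sigma)$, all other values unchanged), and let $i_*: H_k(X_t)\to H_k(X'_t)$ be induced by inclusion. The *cascade* of $\sigma$ is $$\mathrm{Csc}_{\mathcal F}(\sigma)=\{(b_j,d_j)\in\mathrm{dgm}_k(\mathcal F) : \phi_{\mathcal F}(\gamma_j)\ne\phi_{\mathcal F'}(i_*\gamma_j)\}.$$ **Lemma.** Suppose that $\sigma$ is negative in $\mathcal F'$ and that $\mathrm{Csc}_{\mathcal F}(\sigma)=\{(b_1,d_1),\dots,(b_m,d_m)\}$, where $b_1\ge b_2\ge\dots\ge b_m$, with corresponding classes $\gamma_1,\dots,\gamma_m$. Then $m\ge1$ if $\dim\sigma=k+1$, and (A) $w(\sigma)\le d_1\le d_2\le\dots\le d_m$; in particular $(b_1,d_1)\subseteq(b_2,d_2)\subseteq\dots\subseteq(b_m,d_m)$;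 (B) $\phi_{\mathcal F'}(i_*\gamma_1)=\sigma$ (if $m\ge 1$); (C) $\phi_{\mathcal F'}(i_*\gamma_j)=\phi_{\mathcal F}(\gamma_{j-1})$ for $1<j\le m$. -/

import Mathlib

namespace Cascade

section Homology

variable (𝕜 : Type*) [Field 𝕜] {V : Type*}

/-- The subquotient `Z / (Z ∩ B)`. -/
abbrev Subquotient {M : Type*} [AddCommGroup M] [Module 𝕜 M] (Z B : Submodule 𝕜 M) : Type _ :=
  Z ⧸ (B.submoduleOf Z : Submodule 𝕜 Z)

/-- The simplicial boundary operator on formal `𝕜`-linear combinations of finite vertex sets: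
`∂ {v₀ < ⋯ < vₖ} = ∑ i, (-1) ^ i • {v₀, …, vₖ} \ {vᵢ}`. A vertex has boundary `∅` (the simplex of
dimension `-1`), i.e. this is the augmented complex, whose homology is reduced homology. -/
noncomputable def boundary [LinearOrder V] : (Finset V →₀ 𝕜) →ₗ[𝕜] (Finset V →₀ 𝕜) :=
  Finsupp.linearCombination 𝕜 fun s : Finset V =>
    ∑ v ∈ s, Finsupp.single (s.erase v) ((-1 : 𝕜) ^ (s.filter (· < v)).card)

/-- The `k`-chains of `K`: combinations of the simplices of `K` with `k + 1` vertices. -/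
def chains (K : PreAbstractSimplicialComplex V) (k : ℕ) : Submodule 𝕜 (Finset V →₀ 𝕜) :=
  Finsupp.supported 𝕜 𝕜 {s | s ∈ K ∧ s.card = k + 1}

/-- The (reduced) `k`-cycles of `K`. -/
noncomputable def cycles [LinearOrder V] (K : PreAbstractSimplicialComplex V) (k : ℕ) :
    Submodule 𝕜 (Finset V →₀ 𝕜) :=
  chains 𝕜 K k ⊓ LinearMap.ker (boundary 𝕜)

/-- The `k`-boundaries of `K`. -/
noncomputable def boundaries [LinearOrder V] (K : PreAbstractSimplicialComplex V) (k : ℕ) :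
    Submodule 𝕜 (Finset V →₀ 𝕜) :=
  (chains 𝕜 K (k + 1)).map (boundary 𝕜)

/-- Reduced simplicial homology `H_k(K)` with coefficients in `𝕜`: cycles modulo boundaries. -/
abbrev Homology [LinearOrder V] (K : PreAbstractSimplicialComplex V) (k : ℕ) : Type _ :=
  Subquotient 𝕜 (cycles 𝕜 K k) (boundaries 𝕜 K k)

variable {𝕜}

theorem chains_mono {K L : PreAbstractSimplicialComplex V} (h : K ≤ L) (k : ℕ) :
    chains 𝕜 K k ≤ chains 𝕜 L k :=
  Finsupp.supported_mono fun _ hs => ⟨h hs.1, hs.2⟩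

variable [LinearOrder V]

theorem cycles_mono {K L : PreAbstractSimplicialComplex V} (h : K ≤ L) (k : ℕ) :
    cycles 𝕜 K k ≤ cycles 𝕜 L k :=
  inf_le_inf_right _ (chains_mono h k)

theorem boundaries_mono {K L : PreAbstractSimplicialComplex V} (h : K ≤ L) (k : ℕ) :
    boundaries 𝕜 K k ≤ boundaries 𝕜 L k :=
  Submodule.map_mono (chains_mono h (k + 1))

/-- The map `H_k(K) → H_k(L)` induced by an inclusion `K ≤ L` of complexes. -/
noncomputable def homologyMap {K L : PreAbstractSimplicialComplex V} (h : K ≤ L) (k : ℕ) :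
    Homology 𝕜 K k →ₗ[𝕜] Homology 𝕜 L k :=
  Submodule.mapQ _ _ (Submodule.inclusion (cycles_mono h k))
    fun _ hx => boundaries_mono h k hx

theorem homologyMap_comp {K L M : PreAbstractSimplicialComplex V} (h : K ≤ L) (h' : L ≤ M)
    (k : ℕ) (x : Homology 𝕜 K k) :
    homologyMap h' k (homologyMap h k x) = homologyMap (h.trans h') k x := by
  obtain ⟨z, rfl⟩ := Submodule.Quotient.mk_surjective _ x
  rfl

end Homology

/-- A finite filtered simplicial complex with pairwise distinct filtration values: the simplex `s`
enters at time `w s`, and no simplex enters before one of its faces. -/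
structure Filtration (V : Type*) where
  complex : PreAbstractSimplicialComplex V
  finite : complex.faces.Finite
  /-- The filtration value (only its values on simplices of the complex matter). -/
  w : Finset V → ℝ
  mono : ∀ s ∈ complex, ∀ t ∈ complex, t ⊆ s → w t ≤ w s
  injOn : Set.InjOn w complex.faces

namespace Filtration

section Basic

variable {V : Type*}

/-- The complex `X_t` of all simplices with filtration value at most `t`. -/
def upTo (F : Filtration V) (t : ℝ) : PreAbstractSimplicialComplex V where
  faces := {s | s ∈ F.complex ∧ F.w s ≤ t}
  isRelLowerSet_faces := fun s hs =>
    ⟨(F.complex.isRelLowerSet_faces hs.1).1, fun r hr hne =>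
      have hrF := (F.complex.isRelLowerSet_faces hs.1).2 hr hne
      ⟨hrF, (F.mono s hs.1 r hrF hr).trans hs.2⟩⟩

/-- The complex `X_{<t}` of all simplices with filtration value less than `t`. -/
def below (F : Filtration V) (t : ℝ) : PreAbstractSimplicialComplex V where
  faces := {s | s ∈ F.complex ∧ F.w s < t}
  isRelLowerSet_faces := fun s hs =>
    ⟨(F.complex.isRelLowerSet_faces hs.1).1, fun r hr hne =>
      have hrF := (F.complex.isRelLowerSet_faces hs.1).2 hr hne
      ⟨hrF, (F.mono s hs.1 r hrF hr).trans_lt hs.2⟩⟩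

theorem upTo_mono (F : Filtration V) {s t : ℝ} (h : s ≤ t) : F.upTo s ≤ F.upTo t :=
  fun _ hr => ⟨hr.1, hr.2.trans h⟩

theorem below_mono (F : Filtration V) {s t : ℝ} (h : s ≤ t) : F.below s ≤ F.below t :=
  fun _ hr => ⟨hr.1, hr.2.trans_le h⟩

theorem below_le_upTo (F : Filtration V) {s t : ℝ} (h : s ≤ t) : F.below s ≤ F.upTo t :=
  fun _ hr => ⟨hr.1, (hr.2.trans_le h).le⟩

theorem upTo_le_below (F : Filtration V) {s t : ℝ} (h : s < t) : F.upTo s ≤ F.below t :=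
  fun _ hr => ⟨hr.1, hr.2.trans_lt h⟩

/-- `F'` is obtained from `F` by inserting the new simplex `σ`, at the time `F'.w σ`. -/
structure IsInsertion (F F' : Filtration V) (σ : Finset V) : Prop where
  notMem : σ ∉ F.complex
  faces_eq : F'.complex.faces = insert σ F.complex.faces
  w_eq : ∀ s ∈ F.complex, F'.w s = F.w s

theorem IsInsertion.upTo_le {F F' : Filtration V} {σ : Finset V} (h : F.IsInsertion F' σ)
    (t : ℝ) : F.upTo t ≤ F'.upTo t := fun s hs =>
  ⟨show s ∈ F'.complex.faces by rw [h.faces_eq]; exact Or.inr hs.1, (h.w_eq s hs.1).trans_le hs.2⟩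

end Basic

variable {𝕜 : Type*} [Field 𝕜] {V : Type*} [LinearOrder V]

variable (𝕜) in
/-- A simplex `σ` (of dimension `k + 1`) is negative in `F` if its entrance turns some nonzero
`k`-dimensional homology class into a boundary. -/
def IsNegative (F : Filtration V) (σ : Finset V) : Prop :=
  σ ∈ F.complex ∧ ∃ k : ℕ, σ.card = k + 2 ∧
    ∃ x : Homology 𝕜 (F.below (F.w σ)) k, x ≠ 0 ∧
      homologyMap (F.below_le_upTo (le_refl (F.w σ))) k x = 0

/-- The simplex `τ` kills the class `γ`, which lives (and is born) at time `b`: the image of `γ`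
merges with the classes that are older than `γ`, i.e. with the image of `H_k(X_{<b})`, exactly when
`τ` enters (elder rule). -/
def Kills (F : Filtration V) {k : ℕ} {b : ℝ} (γ : Homology 𝕜 (F.upTo b) k) (τ : Finset V) : Prop :=
  τ ∈ F.complex ∧ ∃ h : b < F.w τ,
    homologyMap (F.upTo_le_below h) k γ ∉
      LinearMap.range (homologyMap (𝕜 := 𝕜) (F.below_mono h.le) k) ∧
    homologyMap (F.upTo_mono h.le) k γ ∈
      LinearMap.range (homologyMap (𝕜 := 𝕜) (F.below_le_upTo h.le) k)

/-- At most one simplex kills a given class. -/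
theorem Kills.unique {F : Filtration V} {k : ℕ} {b : ℝ} {γ : Homology 𝕜 (F.upTo b) k}
    {τ τ' : Finset V} (h : F.Kills γ τ) (h' : F.Kills γ τ') : τ = τ' := by
  have key : ∀ τ τ' : Finset V, F.Kills γ τ → F.Kills γ τ' → ¬ F.w τ < F.w τ' := by
    rintro τ τ' ⟨-, hb, -, y, hy⟩ ⟨-, hb', hn, -⟩ hlt
    refine hn ⟨y, ?_⟩
    have := congrArg (homologyMap (F.upTo_le_below hlt) k) hy
    rwa [homologyMap_comp, homologyMap_comp] at this
  exact F.injOn h.1 h'.1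
    (le_antisymm (not_lt.1 (key _ _ h' h)) (not_lt.1 (key _ _ h h')))

open Classical in
/-- The matching `φ_F`: the simplex of `F` that kills `γ`, or `none` if `γ` never dies. -/
noncomputable def killer (F : Filtration V) {k : ℕ} {b : ℝ} (γ : Homology 𝕜 (F.upTo b) k) :
    Option (Finset V) :=
  if h : ∃ τ, F.Kills γ τ then some h.choose else none

/-- The family `(b i, d i, γ i)` is an interval decomposition
`PH_k(F) ≅ ⨁ i, I[b i, d i)`, where `γ i ∈ H_k(X_{b i})` is the generator of the `i`-th summand:
at each time `t` the images of the `γ i` with `b i ≤ t < d i` form a basis of `H_k(X_t)`, and `γ i`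
becomes zero at time `d i`. The points `(b i, d i)` form the persistence diagram `dgm_k(F)`. -/
structure IsIntervalDecomposition (F : Filtration V) (k : ℕ) {ι : Type*} (b : ι → ℝ)
    (d : ι → WithTop ℝ) (γ : ∀ i, Homology 𝕜 (F.upTo (b i)) k) : Prop where
  birth_lt_death : ∀ i, (b i : WithTop ℝ) < d i
  linearIndependent : ∀ t : ℝ, LinearIndependent 𝕜
    fun i : {i : ι // b i ≤ t ∧ (t : WithTop ℝ) < d i} =>
      homologyMap (F.upTo_mono i.2.1) k (γ i)
  span_eq_top : ∀ t : ℝ, Submodule.span 𝕜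
    (Set.range fun i : {i : ι // b i ≤ t ∧ (t : WithTop ℝ) < d i} =>
      homologyMap (F.upTo_mono i.2.1) k (γ i)) = ⊤
  eq_zero : ∀ (i : ι) (t : ℝ) (h : b i ≤ t), d i ≤ t → homologyMap (F.upTo_mono h) k (γ i) = 0

/-- The cascade of the inserted simplex: the (indices of the) points of the persistence diagram of
`F` whose class is killed by another simplex in `F'` than in `F` (or is killed in only one of
them). Here `i_*` is induced by the inclusion of the complexes of `F` in those of `F'`. -/
def cascade {F F' : Filtration V} {σ : Finset V} (hσ : F.IsInsertion F' σ) {k : ℕ} {ι : Type*}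
    (b : ι → ℝ) (γ : ∀ i, Homology 𝕜 (F.upTo (b i)) k) : Set ι :=
  {i | F.killer (γ i) ≠ F'.killer (homologyMap (hσ.upTo_le (b i)) k (γ i))}

end Filtration

end Cascade

/-!
Let `s` be the value of `σ`, and consider the only degree that matters, `dim σ = k + 1`; in all
others `σ` does not affect when a class of `F` merges with older ones
(`IsInsertion.mem_elder_iff_of_card_ne`), so the cascade is empty.

Since `σ` is negative, it kills a nonzero class of `X_s`, represented by a cycle `x`, and from time
`s` on the boundaries of `F'` are those of `F` together with the multiples of `x`
(`IsInsertion.exists_cycle`). Write `x ∼ ∑ a i • z i` in terms of the generators alive at time `s`,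
and let `S ≠ ∅` be the support of `a`. By time `t ≥ s` the terms with `d i ≤ t` have disappeared
from this relation, and setting `x` to zero makes the youngest remaining generator homologous to
older ones, and no other generator (`IsCycleDecomposition.mem_sup_span_iff`). So in `F'` an
interval `i` merges at the first time `t ≥ s` at which it is the youngest of the living intervals
of `S`, if it does not die before in `F`.

Consequently the cascade consists of those `i ∈ S` that outlive all younger members of `S`
(`IsElderRule.mem_cascade_iff`). The youngest member of `S` is killed by `σ`
(`IsElderRule.killer_eq_inserted`). Any other member of the cascade becomes the youngest one alive
when the last younger member of `S` dies, and it is killed at that moment, by the simplex that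
kills that interval in `F` (`IsElderRule.killer_eq_killer`). As births are distinct
(`IsCycleDecomposition.birth_injective`), the interval dying last is the preceding element of the
cascade.
-/

namespace Cascade

/-! ### Chains of a complex and of a subcomplex missing one simplex -/

section Chains

theorem mem_sup_of_le {R M : Type*} [Semiring R] [AddCommMonoid M] [Module R M]
    {S S' T T' : Submodule R M} (hS : S ≤ S') (hT : T ≤ T') {x : M} (hx : x ∈ S ⊔ T) :
    x ∈ S' ⊔ T' :=
  sup_le_sup hS hT hx

variable {𝕜 : Type*} [Field 𝕜] {V : Type*} {K K' : PreAbstractSimplicialComplex V} {σ : Finset V}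

theorem mem_chains_of_apply_eq_zero (hK : ∀ s ∈ K', s ≠ σ → s ∈ K) {k : ℕ}
    {x : Finset V →₀ 𝕜} (hx : x ∈ chains 𝕜 K' k) (h0 : x σ = 0) : x ∈ chains 𝕜 K k := by
  rw [chains, Finsupp.mem_supported] at *
  intro s hs
  refine ⟨hK s (hx hs).1 ?_, (hx hs).2⟩
  rintro rfl
  exact (Finsupp.mem_support_iff.1 hs) h0

theorem apply_eq_zero_of_mem_chains {k : ℕ} {x : Finset V →₀ 𝕜} (hx : x ∈ chains 𝕜 K k)
    (h : σ ∉ K ∨ σ.card ≠ k + 1) : x σ = 0 := by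
  rw [chains, Finsupp.mem_supported'] at hx
  exact hx σ fun hs => h.elim (fun h => h hs.1) fun h => h hs.2

variable [LinearOrder V]

theorem mk_eq_zero_iff {k : ℕ} (z : cycles 𝕜 K k) :
    (Submodule.Quotient.mk z : Homology 𝕜 K k) = 0 ↔
      (z : Finset V →₀ 𝕜) ∈ boundaries 𝕜 K k := by
  rw [Submodule.Quotient.mk_eq_zero]
  rfl

theorem homologyMap_mk_mem_range_iff {L M : PreAbstractSimplicialComplex V} (h : K ≤ M)
    (h' : L ≤ M) {k : ℕ} (z : cycles 𝕜 K k) :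
    homologyMap h k (Submodule.Quotient.mk z) ∈ LinearMap.range (homologyMap (𝕜 := 𝕜) h' k) ↔
      (z : Finset V →₀ 𝕜) ∈ cycles 𝕜 L k ⊔ boundaries 𝕜 M k := by
  have key (y : cycles 𝕜 L k) : homologyMap h' k (Submodule.Quotient.mk y) =
      homologyMap h k (Submodule.Quotient.mk z) ↔
        (y - z : Finset V →₀ 𝕜) ∈ boundaries 𝕜 M k := by
    change (Submodule.Quotient.mk (Submodule.inclusion (cycles_mono h' k) y) : Homology 𝕜 M k) =
      Submodule.Quotient.mk (Submodule.inclusion (cycles_mono h k) z) ↔ _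
    rw [Submodule.Quotient.eq]
    rfl
  rw [Submodule.mem_sup]
  constructor
  · rintro ⟨y, hy⟩
    obtain ⟨y, rfl⟩ := Submodule.Quotient.mk_surjective _ y
    refine ⟨y, y.2, z - y, ?_, by abel⟩
    simpa using neg_mem ((key y).1 hy)
  · rintro ⟨y, hy, u, hu, hz⟩
    refine ⟨Submodule.Quotient.mk ⟨y, hy⟩, (key _).2 ?_⟩
    rw [← hz]
    simpa using hu

theorem mem_cycles_of_apply_eq_zero (hK : ∀ s ∈ K', s ≠ σ → s ∈ K) {k : ℕ}
    {x : Finset V →₀ 𝕜} (hx : x ∈ cycles 𝕜 K' k) (h0 : x σ = 0) : x ∈ cycles 𝕜 K k :=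
  ⟨mem_chains_of_apply_eq_zero hK hx.1 h0, hx.2⟩

theorem exists_sub_smul_mem_boundaries (hK : ∀ s ∈ K', s ≠ σ → s ∈ K) {k : ℕ}
    {x : Finset V →₀ 𝕜} (hx : x ∈ boundaries 𝕜 K' k) :
    ∃ r : 𝕜, x - r • boundary 𝕜 (Finsupp.single σ 1) ∈ boundaries 𝕜 K k := by
  obtain ⟨y, hy, rfl⟩ := hx
  by_cases h : σ ∈ K' ∧ σ.card = k + 2
  · refine ⟨y σ, y - y σ • Finsupp.single σ 1, ?_, by rw [map_sub, map_smul]⟩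
    refine mem_chains_of_apply_eq_zero hK (sub_mem hy (Submodule.smul_mem _ _ ?_)) (by simp)
    exact Finsupp.single_mem_supported 𝕜 _ h
  · refine ⟨0, y, mem_chains_of_apply_eq_zero hK hy
      (apply_eq_zero_of_mem_chains hy (by tauto)), by simp⟩

theorem boundaries_eq_of_card_ne (hle : K ≤ K') (hK : ∀ s ∈ K', s ≠ σ → s ∈ K) {k : ℕ}
    (h : σ.card ≠ k + 2) : boundaries 𝕜 K' k = boundaries 𝕜 K k := by
  refine le_antisymm ?_ (boundaries_mono hle k)
  rintro _ ⟨y, hy, rfl⟩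
  exact ⟨y, mem_chains_of_apply_eq_zero hK hy (apply_eq_zero_of_mem_chains hy (.inr h)), rfl⟩

/-- A simplex outside a complex is not a face of one of its simplices, so it does not occur in
boundaries. -/
theorem apply_eq_zero_of_mem_boundaries {k : ℕ} {x : Finset V →₀ 𝕜} (hx : x ∈ boundaries 𝕜 K k)
    (hne : σ.Nonempty) (h : σ ∉ K) : x σ = 0 := by
  obtain ⟨y, hy, rfl⟩ := hx
  rw [chains, SetLike.mem_coe, Finsupp.mem_supported] at hy
  rw [boundary, Finsupp.linearCombination_apply, Finsupp.sum, Finsupp.finsetSum_apply]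
  refine Finset.sum_eq_zero fun s hs => ?_
  rw [Finsupp.smul_apply, Finsupp.finsetSum_apply, Finset.sum_eq_zero, smul_zero]
  intro v _
  refine Finsupp.single_eq_of_ne ?_
  rintro rfl
  exact h ((K.isRelLowerSet_faces (hy hs).1).2 (Finset.erase_subset _ _) hne)

end Chains

/-! ### Killing simplices as first merging times -/

namespace Filtration

section Complexes

variable {V : Type*}

/-- As only finitely many values occur, `X_{<t} = X_{t'}` for some `t' < t` close to `t`. -/
theorem exists_below_le_upTo (F : Filtration V) {l t : ℝ} (hl : l < t) :
    ∃ t', l ≤ t' ∧ t' < t ∧ F.below t ≤ F.upTo t' := by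
  have h : ∀ᶠ t' in nhdsWithin t (Set.Iio t), ∀ s ∈ F.complex.faces, F.w s < t → F.w s ≤ t' := by
    refine (Filter.eventually_all_finite F.finite).2 fun s _ => ?_
    by_cases hs : F.w s < t
    · filter_upwards [Ico_mem_nhdsLT hs] with t' ht' _ using ht'.1
    · simp [hs]
  obtain ⟨t', h, ht'⟩ := (h.and (Ico_mem_nhdsLT hl)).exists
  exact ⟨t', ht'.1, ht'.2, fun s hs => ⟨hs.1, h s hs.1 hs.2⟩⟩

variable {F F' : Filtration V} {σ : Finset V}

theorem IsInsertion.mem (h : F.IsInsertion F' σ) : σ ∈ F'.complex :=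
  show σ ∈ F'.complex.faces by rw [h.faces_eq]; exact Set.mem_insert _ _

theorem IsInsertion.mem_of_mem (h : F.IsInsertion F' σ) {s : Finset V} (hs : s ∈ F.complex) :
    s ∈ F'.complex :=
  show s ∈ F'.complex.faces by rw [h.faces_eq]; exact Set.mem_insert_of_mem _ hs

theorem IsInsertion.mem_of_ne (h : F.IsInsertion F' σ) {s : Finset V} (hs : s ∈ F'.complex)
    (hne : s ≠ σ) : s ∈ F.complex := by
  have hs' : s ∈ F'.complex.faces := hs
  rw [h.faces_eq] at hs'
  exact hs'.resolve_left hne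

theorem IsInsertion.nonempty (h : F.IsInsertion F' σ) : σ.Nonempty :=
  (F'.complex.isRelLowerSet_faces h.mem).1

theorem IsInsertion.w_ne (h : F.IsInsertion F' σ) {s : Finset V} (hs : s ∈ F.complex) :
    F.w s ≠ F'.w σ := fun he =>
  h.notMem (F'.injOn (h.mem_of_mem hs) h.mem ((h.w_eq s hs).trans he) ▸ hs)

theorem IsInsertion.below_le (h : F.IsInsertion F' σ) (t : ℝ) : F.below t ≤ F'.below t :=
  fun s hs => ⟨h.mem_of_mem hs.1, (h.w_eq s hs.1).trans_lt hs.2⟩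

theorem IsInsertion.mem_upTo_of_ne (h : F.IsInsertion F' σ) (t : ℝ) :
    ∀ s ∈ F'.upTo t, s ≠ σ → s ∈ F.upTo t := fun s hs hne =>
  ⟨h.mem_of_ne hs.1 hne, (h.w_eq s (h.mem_of_ne hs.1 hne)).symm.trans_le hs.2⟩

theorem IsInsertion.mem_below_of_ne (h : F.IsInsertion F' σ) (t : ℝ) :
    ∀ s ∈ F'.below t, s ≠ σ → s ∈ F.below t := fun s hs hne =>
  ⟨h.mem_of_ne hs.1 hne, (h.w_eq s (h.mem_of_ne hs.1 hne)).symm.trans_lt hs.2⟩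

theorem IsInsertion.upTo_le_below (h : F.IsInsertion F' σ) :
    F.upTo (F'.w σ) ≤ F.below (F'.w σ) :=
  fun _ hs => ⟨hs.1, hs.2.lt_of_ne (h.w_ne hs.1)⟩

theorem IsInsertion.upTo_le_upTo_of_lt (h : F.IsInsertion F' σ) {t : ℝ} (ht : t < F'.w σ) :
    F'.upTo t ≤ F.upTo t := fun s hs => by
  refine h.mem_upTo_of_ne t s hs ?_
  rintro rfl
  exact hs.2.not_gt ht

end Complexes

variable {𝕜 : Type*} [Field 𝕜] {V : Type*} [LinearOrder V]

variable (𝕜) in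
/-- The `k`-chains that are homologous in `X_t` to a cycle of `X_{<b}`. A class born at time `b`
has merged with older classes at time `t` iff its representing cycles lie in this submodule. -/
noncomputable def elder (F : Filtration V) (k : ℕ) (b t : ℝ) : Submodule 𝕜 (Finset V →₀ 𝕜) :=
  cycles 𝕜 (F.below b) k ⊔ boundaries 𝕜 (F.upTo t) k

/-- A simplex kills a class iff it enters at the first time at which the class is homologous to an
older cycle. -/
theorem kills_iff {F : Filtration V} {k : ℕ} {b : ℝ} (z : cycles 𝕜 (F.upTo b) k)
    {τ : Finset V} :
    F.Kills (Submodule.Quotient.mk z : Homology 𝕜 (F.upTo b) k) τ ↔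
      τ ∈ F.complex ∧ b < F.w τ ∧ (z : Finset V →₀ 𝕜) ∈ F.elder 𝕜 k b (F.w τ) ∧
        ∀ t, b ≤ t → t < F.w τ → (z : Finset V →₀ 𝕜) ∉ F.elder 𝕜 k b t := by
  simp only [Kills, homologyMap_mk_mem_range_iff]
  refine and_congr_right fun _ => ?_
  constructor
  · rintro ⟨hb, h1, h2⟩
    exact ⟨hb, h2, fun t _ ht hz =>
      h1 (mem_sup_of_le le_rfl (boundaries_mono (F.upTo_le_below ht) k) hz)⟩
  · rintro ⟨hb, h1, h2⟩
    refine ⟨hb, fun hz => ?_, h1⟩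
    obtain ⟨t, hbt, ht, hle⟩ := F.exists_below_le_upTo hb
    exact h2 t hbt ht (mem_sup_of_le le_rfl (boundaries_mono hle k) hz)

/-- A first merging time is the value of a simplex, as the complex must change there. -/
theorem exists_kills {F : Filtration V} {k : ℕ} {b t : ℝ} (z : cycles 𝕜 (F.upTo b) k)
    (hb : b < t) (h1 : (z : Finset V →₀ 𝕜) ∈ F.elder 𝕜 k b t)
    (h2 : ∀ t', b ≤ t' → t' < t → (z : Finset V →₀ 𝕜) ∉ F.elder 𝕜 k b t') :
    ∃ τ, F.w τ = t ∧ F.Kills (Submodule.Quotient.mk z : Homology 𝕜 (F.upTo b) k) τ := by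
  by_cases h : ∃ τ ∈ F.complex, F.w τ = t
  · obtain ⟨τ, hτ, rfl⟩ := h
    exact ⟨τ, rfl, (kills_iff z).2 ⟨hτ, hb, h1, h2⟩⟩
  · obtain ⟨t', hbt, ht, hle⟩ := F.exists_below_le_upTo hb
    have hle' : F.upTo t ≤ F.upTo t' := fun s hs =>
      hle ⟨hs.1, hs.2.lt_of_ne fun he => h ⟨s, hs.1, he⟩⟩
    exact absurd (mem_sup_of_le le_rfl (boundaries_mono hle' k) h1) (h2 t' hbt ht)

theorem killer_eq_some_iff {F : Filtration V} {k : ℕ} {b : ℝ} {γ : Homology 𝕜 (F.upTo b) k}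
    {τ : Finset V} : F.killer γ = some τ ↔ F.Kills γ τ := by
  unfold killer
  split_ifs with h
  · exact ⟨fun he => Option.some.inj he ▸ h.choose_spec,
      fun hτ => congrArg some (h.choose_spec.unique hτ)⟩
  · simpa using fun hτ => h ⟨τ, hτ⟩

/-! ### Insertion of a simplex -/

section Insertion

variable {F F' : Filtration V} {σ : Finset V}

/-- A class that merges with older ones at the same times in both filtrations has the same killer,
since the two filtrations assign the same value to a common simplex. -/
theorem IsInsertion.killer_eq (h : F.IsInsertion F' σ) {k : ℕ} {b : ℝ}
    (z : cycles 𝕜 (F.upTo b) k)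
    (hz : ∀ t, b ≤ t →
      ((z : Finset V →₀ 𝕜) ∈ F'.elder 𝕜 k b t ↔ (z : Finset V →₀ 𝕜) ∈ F.elder 𝕜 k b t)) :
    F.killer (Submodule.Quotient.mk z : Homology 𝕜 (F.upTo b) k) =
      F'.killer (homologyMap (h.upTo_le b) k (Submodule.Quotient.mk z)) := by
  change _ = F'.killer (Submodule.Quotient.mk (Submodule.inclusion (cycles_mono (h.upTo_le b) k) z))
  ext τ
  rw [killer_eq_some_iff, killer_eq_some_iff]
  constructor
  · rw [kills_iff, kills_iff]
    rintro ⟨hτ, hb, h1, h2⟩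
    rw [h.w_eq τ hτ]
    exact ⟨h.mem_of_mem hτ, hb, (hz _ hb.le).2 h1, fun t hbt ht h' => h2 t hbt ht ((hz t hbt).1 h')⟩
  · rw [kills_iff]
    rintro ⟨hτ, hb, h1, h2⟩
    obtain ⟨τ', hw, hk⟩ := exists_kills z hb ((hz _ hb.le).1 h1)
      fun t hbt ht h' => h2 t hbt ht ((hz t hbt).2 h')
    rwa [F'.injOn hτ (h.mem_of_mem hk.1) (hw.symm.trans (h.w_eq τ' hk.1).symm)]

theorem IsInsertion.cycles_below (h : F.IsInsertion F' σ) {k : ℕ} (hcard : σ.card ≠ k + 1)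
    (t : ℝ) : cycles 𝕜 (F'.below t) k = cycles 𝕜 (F.below t) k :=
  le_antisymm (fun _ hx => mem_cycles_of_apply_eq_zero (h.mem_below_of_ne t) hx
    (apply_eq_zero_of_mem_chains hx.1 (.inr hcard))) (cycles_mono (h.below_le t) k)

/-- If `dim σ ≠ k + 1` then `σ` adds no `k`-boundaries, and a new cycle through `σ` is never
homologous to an old one because `σ` has no cofaces. -/
theorem IsInsertion.mem_elder_iff_of_card_ne (h : F.IsInsertion F' σ) {k : ℕ}
    (hcard : σ.card ≠ k + 2) {b : ℝ} (z : cycles 𝕜 (F.upTo b) k) (t : ℝ) :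
    (z : Finset V →₀ 𝕜) ∈ F'.elder 𝕜 k b t ↔ (z : Finset V →₀ 𝕜) ∈ F.elder 𝕜 k b t := by
  rw [elder, elder, boundaries_eq_of_card_ne (h.upTo_le t) (h.mem_upTo_of_ne t) hcard]
  refine ⟨fun hz => ?_, fun hz => mem_sup_of_le (cycles_mono (h.below_le b) k) le_rfl hz⟩
  obtain ⟨y, hy, u, hu, hyu⟩ := Submodule.mem_sup.1 hz
  refine Submodule.mem_sup.2 ⟨y, mem_cycles_of_apply_eq_zero (h.mem_below_of_ne b) hy ?_, u, hu, hyu⟩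
  have hzσ := apply_eq_zero_of_mem_chains z.2.1 (σ := σ) (.inl fun hs => h.notMem hs.1)
  have huσ := apply_eq_zero_of_mem_boundaries hu h.nonempty fun hs => h.notMem hs.1
  rwa [← hyu, Finsupp.add_apply, huσ, add_zero] at hzσ

/-- The class that the negative simplex `σ` kills on its entrance, as a cycle `x`: from then on the
boundaries of the new filtration are spanned by the old ones and `x`. -/
theorem IsInsertion.exists_cycle (h : F.IsInsertion F' σ) (hneg : F'.IsNegative 𝕜 σ) {k : ℕ}
    (hcard : σ.card = k + 2) :
    ∃ x ∈ cycles 𝕜 (F.upTo (F'.w σ)) k, x ∉ boundaries 𝕜 (F.upTo (F'.w σ)) k ∧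
      ∀ t, F'.w σ ≤ t →
        boundaries 𝕜 (F'.upTo t) k = boundaries 𝕜 (F.upTo t) k ⊔ Submodule.span 𝕜 {x} := by
  obtain ⟨-, k', hk', x, hx0, hx⟩ := hneg
  obtain rfl : k' = k := by omega
  obtain ⟨x, rfl⟩ := Submodule.Quotient.mk_surjective _ x
  have hxB : (x : Finset V →₀ 𝕜) ∈ boundaries 𝕜 (F'.upTo (F'.w σ)) k' :=
    (mk_eq_zero_iff (Submodule.inclusion (cycles_mono (F'.below_le_upTo le_rfl) k') x)).1 hx
  have hxB' : (x : Finset V →₀ 𝕜) ∉ boundaries 𝕜 (F.upTo (F'.w σ)) k' := fun hb =>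
    hx0 ((mk_eq_zero_iff x).2
      (boundaries_mono (h.upTo_le_below.trans (h.below_le _)) k' hb))
  obtain ⟨r, hr⟩ := exists_sub_smul_mem_boundaries (h.mem_upTo_of_ne _) hxB
  have hr0 : r ≠ 0 := by
    rintro rfl
    exact hxB' (by simpa using hr)
  refine ⟨x, ?_, hxB', fun t ht => le_antisymm (fun y hy => ?_) (sup_le
    (boundaries_mono (h.upTo_le t) k') ?_)⟩
  · have hc : σ.card ≠ k' + 1 := by omega
    exact cycles_mono (F.below_le_upTo le_rfl) k' ((h.cycles_below hc _).le x.2)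
  · obtain ⟨q, hq⟩ := exists_sub_smul_mem_boundaries (h.mem_upTo_of_ne _) hy
    have hr' := boundaries_mono (F.upTo_mono ht) k' hr
    -- eliminate the boundary of `σ` from the expressions for `x` and `y`
    refine Submodule.mem_sup.2 ⟨_, sub_mem hq (Submodule.smul_mem _ (q * r⁻¹) hr'),
      (q * r⁻¹) • (x : Finset V →₀ 𝕜),
      Submodule.smul_mem _ _ (Submodule.mem_span_singleton_self _), ?_⟩
    rw [smul_sub, smul_smul, mul_assoc, inv_mul_cancel₀ hr0, mul_one]
    abel
  · rw [Submodule.span_singleton_le_iff_mem]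
    exact boundaries_mono (F'.upTo_mono ht) k' hxB

end Insertion

/-! ### Interval decompositions on the level of cycles -/

variable {ι : Type*}

/-- An interval decomposition at the level of cycles: `z i` is a cycle of `X_{b i}` representing the
generator of the `i`-th summand. In `linearCombination_mem` only the coefficients of the intervals
alive at time `t` are claimed to vanish, so that dead intervals may occur in `a`. -/
structure IsCycleDecomposition (F : Filtration V) (k : ℕ) (b : ι → ℝ) (d : ι → WithTop ℝ)
    (z : ι → Finset V →₀ 𝕜) : Prop where
  birth_lt_death : ∀ i, (b i : WithTop ℝ) < d i
  mem_cycles : ∀ i, z i ∈ cycles 𝕜 (F.upTo (b i)) k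
  mem_boundaries : ∀ i (t : ℝ), b i ≤ t → d i ≤ t → z i ∈ boundaries 𝕜 (F.upTo t) k
  exists_linearCombination : ∀ (t : ℝ), ∀ x ∈ cycles 𝕜 (F.upTo t) k, ∃ a : ι →₀ 𝕜,
    (∀ i, a i ≠ 0 → b i ≤ t ∧ (t : WithTop ℝ) < d i) ∧
      x - Finsupp.linearCombination 𝕜 z a ∈ boundaries 𝕜 (F.upTo t) k
  linearCombination_mem : ∀ (t : ℝ) (a : ι →₀ 𝕜), (∀ i, a i ≠ 0 → b i ≤ t) →
    Finsupp.linearCombination 𝕜 z a ∈ boundaries 𝕜 (F.upTo t) k →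
      ∀ i, (t : WithTop ℝ) < d i → a i = 0

/-- A combination of the images of the generators in `H_k(X_t)` is represented by the same
combination of the representing cycles. -/
theorem linearCombination_homologyMap_mk (F : Filtration V) {k : ℕ} {b : ι → ℝ} {t : ℝ}
    {p : ι → Prop} (hp : ∀ i, p i → b i ≤ t) (z : ∀ i, cycles 𝕜 (F.upTo (b i)) k)
    (a : {i // p i} →₀ 𝕜) :
    ∃ y : cycles 𝕜 (F.upTo t) k,
      (y : Finset V →₀ 𝕜) =
        Finsupp.linearCombination 𝕜 (fun i => (z i : Finset V →₀ 𝕜)) (a.mapDomain (↑)) ∧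
      Finsupp.linearCombination 𝕜 (fun i : {i // p i} => homologyMap (F.upTo_mono (hp i i.2)) k
        (Submodule.Quotient.mk (z i) : Homology 𝕜 (F.upTo (b i)) k)) a =
          Submodule.Quotient.mk y := by
  refine ⟨Finsupp.linearCombination 𝕜 (fun i : {i // p i} =>
    Submodule.inclusion (cycles_mono (F.upTo_mono (hp i i.2)) k) (z i)) a, ?_, ?_⟩
  · rw [Finsupp.linearCombination_mapDomain]
    exact Finsupp.apply_linearCombination 𝕜 (Submodule.subtype _) _ a
  · exact (Finsupp.apply_linearCombination 𝕜 (Submodule.mkQ _) _ a).symm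

theorem IsIntervalDecomposition.isCycleDecomposition {F : Filtration V} {k : ℕ} {b : ι → ℝ}
    {d : ι → WithTop ℝ} {z : ∀ i, cycles 𝕜 (F.upTo (b i)) k}
    (h : F.IsIntervalDecomposition k b d
      fun i => (Submodule.Quotient.mk (z i) : Homology 𝕜 (F.upTo (b i)) k)) :
    F.IsCycleDecomposition k b d fun i => (z i : Finset V →₀ 𝕜) := by
  have hdead (i : ι) (t : ℝ) (hb : b i ≤ t) (hd : d i ≤ t) :
      (z i : Finset V →₀ 𝕜) ∈ boundaries 𝕜 (F.upTo t) k :=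
    (mk_eq_zero_iff (Submodule.inclusion (cycles_mono (F.upTo_mono hb) k) (z i))).1
      (h.eq_zero i t hb hd)
  refine ⟨h.birth_lt_death, fun i => (z i).2, hdead, fun t x hx => ?_, fun t a ha hmem i hi => ?_⟩
  · have hspan : (Submodule.Quotient.mk ⟨x, hx⟩ : Homology 𝕜 (F.upTo t) k) ∈
        Submodule.span 𝕜 (Set.range _) := h.span_eq_top t ▸ Submodule.mem_top
    obtain ⟨a, ha⟩ := Finsupp.mem_span_range_iff_exists_finsupp.1 hspan
    obtain ⟨y, hy, hya⟩ := linearCombination_homologyMap_mk F (t := t)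
      (p := fun i => b i ≤ t ∧ (t : WithTop ℝ) < d i) (fun i hi => hi.1) z a
    refine ⟨a.mapDomain (↑), fun i hi => ?_, ?_⟩
    · by_contra hni
      exact hi (Finsupp.mapDomain_of_notMem_range _ _ (by simpa using hni))
    · rw [← hy]
      exact (Submodule.Quotient.eq (x := (⟨x, hx⟩ : cycles 𝕜 (F.upTo t) k)) _).1 (ha.symm.trans hya)
  · classical
    set p : ι → Prop := fun i => b i ≤ t ∧ (t : WithTop ℝ) < d i
    obtain ⟨y, hy, hya⟩ := linearCombination_homologyMap_mk F (t := t)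
      (p := p) (fun i hi => hi.1) z (a.subtypeDomain p)
    have hfilter : (a.subtypeDomain p).mapDomain (↑) = a.filter p := by
      ext j
      by_cases hj : p j
      · rw [Finsupp.filter_apply_pos p a hj]
        exact Finsupp.mapDomain_apply Subtype.val_injective _ (⟨j, hj⟩ : {i // p i})
      · rw [Finsupp.filter_apply_neg p a hj,
          Finsupp.mapDomain_of_notMem_range _ _ (by simpa using hj)]
    have hrest : Finsupp.linearCombination 𝕜 (fun i => (z i : Finset V →₀ 𝕜))
        (a.filter fun i => ¬ p i) ∈ boundaries 𝕜 (F.upTo t) k := by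
      refine Submodule.sum_mem _ fun j hj => Submodule.smul_mem _ _ ?_
      rw [Finsupp.support_filter, Finset.mem_filter, Finsupp.mem_support_iff] at hj
      exact hdead j t (ha j hj.1) (not_lt.1 fun hlt => hj.2 ⟨ha j hj.1, hlt⟩)
    have hyB : (y : Finset V →₀ 𝕜) ∈ boundaries 𝕜 (F.upTo t) k := by
      rw [← Finsupp.filter_add_filter_not a p, map_add, ← hfilter, ← hy] at hmem
      exact (Submodule.add_mem_iff_left _ hrest).1 hmem
    have h0 := linearIndependent_iff.1 (h.linearIndependent t) (a.subtypeDomain p)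
      (hya.trans ((mk_eq_zero_iff y).2 hyB))
    by_contra hai
    exact hai (DFunLike.congr_fun h0 ⟨i, ha i hai, hi⟩)

section Decomposition

variable {F : Filtration V} {k : ℕ} {b : ι → ℝ} {d : ι → WithTop ℝ} {z : ι → Finset V →₀ 𝕜}

/-- The intervals born before `β` span the older classes, so a combination of generators that is
homologous to an older cycle involves no living interval born at or after `β`. -/
theorem IsCycleDecomposition.apply_eq_zero (h : F.IsCycleDecomposition k b d z) {β t : ℝ}
    (hβ : β ≤ t) {a : ι →₀ 𝕜} (ha : ∀ i, a i ≠ 0 → b i ≤ t)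
    (hmem : Finsupp.linearCombination 𝕜 z a ∈ F.elder 𝕜 k β t) {i : ι} (hb : β ≤ b i)
    (hd : (t : WithTop ℝ) < d i) : a i = 0 := by
  obtain ⟨y, hy, u, hu, hyu⟩ := Submodule.mem_sup.1 hmem
  obtain ⟨t', -, ht', hle⟩ := F.exists_below_le_upTo (sub_one_lt β)
  obtain ⟨e, he, hye⟩ := h.exists_linearCombination t' y (cycles_mono hle k hy)
  have hei : e i = 0 := by
    by_contra hei
    exact ((he i hei).1.trans_lt ht').not_ge hb
  have key := h.linearCombination_mem t (a - e) (fun j hj => ?_) ?_ i hd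
  · rwa [Finsupp.sub_apply, hei, sub_zero] at key
  · by_cases haj : a j = 0
    · refine (he j fun hej => hj ?_).1.trans (ht'.le.trans hβ)
      rw [Finsupp.sub_apply, haj, hej, sub_zero]
    · exact ha j haj
  · rw [map_sub, ← hyu, add_sub_right_comm]
    exact add_mem (boundaries_mono (F.upTo_mono (ht'.le.trans hβ)) k hye) hu

theorem IsCycleDecomposition.mem_elder_iff (h : F.IsCycleDecomposition k b d z) {i : ι} {t : ℝ}
    (hb : b i ≤ t) : z i ∈ F.elder 𝕜 k (b i) t ↔ d i ≤ t := by
  refine ⟨fun hz => not_lt.1 fun hd => one_ne_zero (α := 𝕜) ?_, fun hd =>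
    Submodule.mem_sup_right (h.mem_boundaries i t hb hd)⟩
  have := h.apply_eq_zero hb (a := Finsupp.single i 1) (fun j hj => ?_) (by simpa using hz) le_rfl hd
  · simp at this
  · rwa [← (Finsupp.single_apply_ne_zero.1 hj).1] at hb

/-- Distinct intervals have distinct births: the single simplex entering at time `β` can be
eliminated from a combination of two cycles of `X_β`. -/
theorem IsCycleDecomposition.birth_injective (h : F.IsCycleDecomposition k b d z) :
    Function.Injective b := by
  intro i j hij
  by_contra hne
  obtain ⟨τ, hτ⟩ : ∃ τ, ∀ s ∈ F.upTo (b i), s ≠ τ → s ∈ F.below (b i) := by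
    by_cases hex : ∃ τ ∈ F.complex, F.w τ = b i
    · obtain ⟨τ, hτ, hw⟩ := hex
      exact ⟨τ, fun s hs hsτ => ⟨hs.1, hs.2.lt_of_ne fun he =>
        hsτ (F.injOn hs.1 hτ (he.trans hw.symm))⟩⟩
    · exact ⟨∅, fun s hs _ => ⟨hs.1, hs.2.lt_of_ne fun he => hex ⟨s, hs.1, he⟩⟩⟩
  have hzi := h.mem_cycles i
  have hzj : z j ∈ cycles 𝕜 (F.upTo (b i)) k := hij ▸ h.mem_cycles j
  -- a combination of `z i` and `z j` without the simplex `τ` is an older cycle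
  have key (p q : 𝕜) (hpq : p * z i τ + q * z j τ = 0) : p = 0 ∧ q = 0 := by
    set a : ι →₀ 𝕜 := Finsupp.single i p + Finsupp.single j q
    have ha : ∀ l, a l ≠ 0 → b l ≤ b i := by
      intro l hl
      by_contra hlt
      have hli : l ≠ i := by rintro rfl; exact hlt le_rfl
      have hlj : l ≠ j := by rintro rfl; exact hlt hij.ge
      exact hl (by simp [a, hli, hlj])
    have hmem : Finsupp.linearCombination 𝕜 z a ∈ F.elder 𝕜 k (b i) (b i) := by
      refine Submodule.mem_sup_left (mem_cycles_of_apply_eq_zero hτ (x := _) ?_ ?_)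
      · simpa [a] using add_mem (Submodule.smul_mem _ p hzi) (Submodule.smul_mem _ q hzj)
      · simpa [a] using hpq
    have h1 := h.apply_eq_zero le_rfl ha hmem le_rfl (h.birth_lt_death i)
    have h2 := h.apply_eq_zero le_rfl ha hmem hij.le (hij ▸ h.birth_lt_death j)
    exact ⟨by simpa [a, hne] using h1, by simpa [a, Ne.symm hne] using h2⟩
  by_cases h0 : z i τ = 0
  · exact one_ne_zero (key 1 0 (by simp [h0])).1
  · exact h0 (neg_eq_zero.1 (key (z j τ) (-z i τ) (by ring)).2)

/-- The elder rule for `x ∼ ∑ j, a j • z j`: once `x` is added to the boundaries, the living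
interval `i` becomes older iff it is the youngest living one in the support of `a`. -/
theorem IsCycleDecomposition.mem_sup_span_iff (h : F.IsCycleDecomposition k b d z) {s t : ℝ}
    (hst : s ≤ t) {x : Finset V →₀ 𝕜} {a : ι →₀ 𝕜}
    (ha : ∀ i, a i ≠ 0 → b i ≤ s)
    (hx : x - Finsupp.linearCombination 𝕜 z a ∈ boundaries 𝕜 (F.upTo s) k) {i : ι}
    (hb : b i ≤ t) (hd : (t : WithTop ℝ) < d i) :
    z i ∈ F.elder 𝕜 k (b i) t ⊔ Submodule.span 𝕜 {x} ↔
      a i ≠ 0 ∧ ∀ j, a j ≠ 0 → b i < b j → d j ≤ t := by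
  have hxt : x - Finsupp.linearCombination 𝕜 z a ∈ F.elder 𝕜 k (b i) t :=
    Submodule.mem_sup_right (boundaries_mono (F.upTo_mono hst) k hx)
  constructor
  · intro hz
    obtain ⟨y, hy, v, hv, hyv⟩ := Submodule.mem_sup.1 hz
    obtain ⟨r, rfl⟩ := Submodule.mem_span_singleton.1 hv
    have hmem : Finsupp.linearCombination 𝕜 z (Finsupp.single i 1 - r • a) ∈
        F.elder 𝕜 k (b i) t := by
      have : Finsupp.linearCombination 𝕜 z (Finsupp.single i 1 - r • a) =
          y + r • (x - Finsupp.linearCombination 𝕜 z a) := by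
        rw [map_sub, map_smul, Finsupp.linearCombination_single, one_smul, ← hyv, smul_sub]
        abel
      exact this ▸ add_mem hy (Submodule.smul_mem _ r hxt)
    have hsupp : ∀ j, (Finsupp.single i 1 - r • a : ι →₀ 𝕜) j ≠ 0 → b j ≤ t := by
      intro j hj
      by_contra hlt
      have hji : j ≠ i := by rintro rfl; exact hlt hb
      have haj : a j = 0 := by
        by_contra haj
        exact hlt ((ha j haj).trans hst)
      exact hj (by simp [hji, haj])
    have hi := h.apply_eq_zero hb hsupp hmem le_rfl hd
    have hrai : r * a i = 1 := (sub_eq_zero.1 (by simpa using hi)).symm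
    refine ⟨right_ne_zero_of_mul_eq_one hrai, fun j haj hij => not_lt.1 fun hdj => ?_⟩
    have hji : j ≠ i := by rintro rfl; exact hij.false
    have hj := h.apply_eq_zero hb hsupp hmem hij.le hdj
    exact mul_ne_zero (left_ne_zero_of_mul_eq_one hrai) haj (by simpa [hji] using hj)
  · classical
    rintro ⟨hai, hyoung⟩
    have hall : Finsupp.linearCombination 𝕜 z a ∈
        F.elder 𝕜 k (b i) t ⊔ Submodule.span 𝕜 {x} := by
      rw [← sub_sub_cancel x (Finsupp.linearCombination 𝕜 z a)]
      exact sub_mem (Submodule.mem_sup_right (Submodule.mem_span_singleton_self x))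
        (Submodule.mem_sup_left hxt)
    have hrest : Finsupp.linearCombination 𝕜 z (a.erase i) ∈
        F.elder 𝕜 k (b i) t ⊔ Submodule.span 𝕜 {x} := by
      refine Submodule.sum_mem _ fun j hj => Submodule.smul_mem _ _ (Submodule.mem_sup_left ?_)
      rw [Finsupp.support_erase, Finset.mem_erase, Finsupp.mem_support_iff] at hj
      rcases lt_or_gt_of_ne (h.birth_injective.ne hj.1) with hlt | hlt
      · exact Submodule.mem_sup_left (cycles_mono (F.upTo_le_below hlt) k (h.mem_cycles j))
      · exact Submodule.mem_sup_right
          (h.mem_boundaries j t ((ha j hj.2).trans hst) (hyoung j hj.2 hlt))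
    rw [← Finsupp.single_add_erase i a, map_add, Finsupp.linearCombination_single,
      Submodule.add_mem_iff_left _ hrest] at hall
    exact (Submodule.smul_mem_iff _ hai).1 hall

end Decomposition

/-! ### The elder rule for the inserted simplex -/

variable {F F' : Filtration V} {σ : Finset V} {k : ℕ} {b : ι → ℝ} {d : ι → WithTop ℝ}

theorem IsCycleDecomposition.death_eq_of_killer {z : ∀ i, cycles 𝕜 (F.upTo (b i)) k}
    (hz : F.IsCycleDecomposition k b d fun i => (z i : Finset V →₀ 𝕜)) {i : ι} {τ : Finset V}
    (hτ : F.killer (Submodule.Quotient.mk (z i) : Homology 𝕜 (F.upTo (b i)) k) = some τ) :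
    τ ∈ F.complex ∧ d i = F.w τ := by
  rw [killer_eq_some_iff, kills_iff] at hτ
  obtain ⟨hτ, hb, h1, h2⟩ := hτ
  refine ⟨hτ, le_antisymm ((hz.mem_elder_iff hb.le).1 h1) (not_lt.1 fun hlt => ?_)⟩
  obtain ⟨r, hr⟩ := WithTop.ne_top_iff_exists.1 hlt.ne_top
  have hbr : b i ≤ r := by exact_mod_cast hr ▸ (hz.birth_lt_death i).le
  exact h2 r hbr (by exact_mod_cast hr ▸ hlt) ((hz.mem_elder_iff hbr).2 hr.ge)

theorem IsCycleDecomposition.exists_killer_eq {z : ∀ i, cycles 𝕜 (F.upTo (b i)) k}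
    (hz : F.IsCycleDecomposition k b d fun i => (z i : Finset V →₀ 𝕜)) {i : ι} {r : ℝ}
    (hr : d i = r) : ∃ τ ∈ F.complex, F.w τ = r ∧
      F.killer (Submodule.Quotient.mk (z i) : Homology 𝕜 (F.upTo (b i)) k) = some τ := by
  have hbr : b i < r := by exact_mod_cast hr ▸ hz.birth_lt_death i
  obtain ⟨τ, hw, hτ⟩ := exists_kills (z i) hbr ((hz.mem_elder_iff hbr.le).2 hr.le)
    fun t hbt ht hmem => by
      have := (hz.mem_elder_iff hbt).1 hmem
      rw [hr] at this
      exact ht.not_ge (by exact_mod_cast this)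
  exact ⟨τ, hτ.1, hw, killer_eq_some_iff.2 hτ⟩

/-- The coefficients `a` of the cycle killed by `σ`, in terms of the generators `z`, and the elder
rule they govern: while the interval `i` is alive in `F`, it has merged with older classes in `F'`
iff `σ` has entered and `i` is the youngest living interval in the support of `a`. -/
structure IsElderRule (F F' : Filtration V) (σ : Finset V) (k : ℕ) (b : ι → ℝ) (d : ι → WithTop ℝ)
    (z : ι → Finset V →₀ 𝕜) (a : ι →₀ 𝕜) : Prop where
  ne_zero : a ≠ 0
  birth_lt : ∀ i, a i ≠ 0 → b i < F'.w σ
  lt_death : ∀ i, a i ≠ 0 → (F'.w σ : WithTop ℝ) < d i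
  mem_elder_iff : ∀ i (t : ℝ), b i ≤ t → (t : WithTop ℝ) < d i →
    (z i ∈ F'.elder 𝕜 k (b i) t ↔
      F'.w σ ≤ t ∧ a i ≠ 0 ∧ ∀ j, a j ≠ 0 → b i < b j → d j ≤ t)

theorem IsInsertion.exists_isElderRule (h : F.IsInsertion F' σ) (hneg : F'.IsNegative 𝕜 σ)
    (hcard : σ.card = k + 2) {z : ι → Finset V →₀ 𝕜} (hz : F.IsCycleDecomposition k b d z) :
    ∃ a : ι →₀ 𝕜, IsElderRule F F' σ k b d z a := by
  obtain ⟨x, hx, hxB, hspan⟩ := h.exists_cycle hneg hcard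
  obtain ⟨a, ha, hxa⟩ := hz.exists_linearCombination _ x hx
  have hcyc (t : ℝ) : cycles 𝕜 (F'.below t) k = cycles 𝕜 (F.below t) k :=
    h.cycles_below (by omega) t
  refine ⟨a, ?_, fun i hi => (ha i hi).1.lt_of_ne fun he => ?_, fun i hi => (ha i hi).2,
    fun i t hb hd => ?_⟩
  · rintro rfl
    exact hxB (by simpa using hxa)
  · have hzi : z i ∈ F.elder 𝕜 k (b i) (b i) := by
      refine Submodule.mem_sup_left (cycles_mono ?_ k (hz.mem_cycles i))
      rw [he]
      exact h.upTo_le_below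
    exact (hz.birth_lt_death i).not_ge ((hz.mem_elder_iff le_rfl).1 hzi)
  · rcases lt_or_ge t (F'.w σ) with ht | ht
    · have he : F'.elder 𝕜 k (b i) t = F.elder 𝕜 k (b i) t := by
        rw [elder, elder, hcyc, le_antisymm (h.upTo_le_upTo_of_lt ht) (h.upTo_le t)]
      rw [he, hz.mem_elder_iff hb]
      exact iff_of_false hd.not_ge fun hs => ht.not_ge hs.1
    · have he : F'.elder 𝕜 k (b i) t = F.elder 𝕜 k (b i) t ⊔ Submodule.span 𝕜 {x} := by
        rw [elder, elder, hcyc, hspan t ht, sup_assoc]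
      rw [he, hz.mem_sup_span_iff ht (fun i hi => (ha i hi).1) hxa hb hd]
      exact (and_iff_right ht).symm

section Rule

variable {z : ∀ i, cycles 𝕜 (F.upTo (b i)) k} {a : ι →₀ 𝕜}

theorem IsElderRule.killer_eq_some (h : F.IsInsertion F' σ)
    (ha : IsElderRule F F' σ k b d (fun i => (z i : Finset V →₀ 𝕜)) a) {i : ι} (hi : a i ≠ 0)
    {τ : Finset V} (hτ : τ ∈ F'.complex) (hs : F'.w σ ≤ F'.w τ)
    (hd : (F'.w τ : WithTop ℝ) < d i)
    (hold : ∀ j, a j ≠ 0 → b i < b j → d j ≤ F'.w τ)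
    (hlast : ∀ t, F'.w σ ≤ t → t < F'.w τ → ∃ j, a j ≠ 0 ∧ b i < b j ∧ (t : WithTop ℝ) < d j) :
    F'.killer (homologyMap (h.upTo_le (b i)) k
      (Submodule.Quotient.mk (z i) : Homology 𝕜 (F.upTo (b i)) k)) = some τ := by
  have hb := (ha.birth_lt i hi).trans_le hs
  refine killer_eq_some_iff.2
    ((kills_iff (Submodule.inclusion (cycles_mono (h.upTo_le (b i)) k) (z i))).2
      ⟨hτ, hb, (ha.mem_elder_iff i _ hb.le hd).2 ⟨hs, hi, hold⟩, fun t hbt ht hmem => ?_⟩)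
  obtain ⟨hst, -, hle⟩ :=
    (ha.mem_elder_iff i t hbt ((WithTop.coe_lt_coe.2 ht).trans hd)).1 hmem
  obtain ⟨j, hj, hbj, hdj⟩ := hlast t hst ht
  exact hdj.not_ge (hle j hj hbj)

theorem IsElderRule.killer_eq_inserted (h : F.IsInsertion F' σ)
    (ha : IsElderRule F F' σ k b d (fun i => (z i : Finset V →₀ 𝕜)) a) {i : ι} (hi : a i ≠ 0)
    (hmax : ∀ j, a j ≠ 0 → b j ≤ b i) :
    F'.killer (homologyMap (h.upTo_le (b i)) k
      (Submodule.Quotient.mk (z i) : Homology 𝕜 (F.upTo (b i)) k)) = some σ :=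
  ha.killer_eq_some h hi h.mem le_rfl (ha.lt_death i hi)
    (fun j hj hbj => absurd hbj (hmax j hj).not_gt) fun _ hst ht => absurd ht hst.not_gt

/-- If `j` is the longest living of the intervals younger than `i` in the support of `a`, then `i`
becomes the youngest one, hence dies in `F'`, when `j` dies in `F`. -/
theorem IsElderRule.killer_eq_killer (h : F.IsInsertion F' σ)
    (hz : F.IsCycleDecomposition k b d fun i => (z i : Finset V →₀ 𝕜))
    (ha : IsElderRule F F' σ k b d (fun i => (z i : Finset V →₀ 𝕜)) a) {i j : ι} (hi : a i ≠ 0)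
    (hj : a j ≠ 0) (hb : b i < b j) (hd : d j < d i)
    (hmax : ∀ l, a l ≠ 0 → b i < b l → d l ≤ d j) :
    F'.killer (homologyMap (h.upTo_le (b i)) k
      (Submodule.Quotient.mk (z i) : Homology 𝕜 (F.upTo (b i)) k)) =
        F.killer (Submodule.Quotient.mk (z j) : Homology 𝕜 (F.upTo (b j)) k) := by
  obtain ⟨r, hr⟩ := WithTop.ne_top_iff_exists.1 hd.ne_top
  obtain ⟨τ, hτ, hw, hkill⟩ := hz.exists_killer_eq hr.symm
  have hw' : F'.w τ = r := (h.w_eq τ hτ).trans hw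
  have hs := ha.lt_death j hj
  rw [← hr] at hd hmax hs
  rw [hkill]
  refine ha.killer_eq_some h hi (h.mem_of_mem hτ) ?_ (hw' ▸ hd) (hw' ▸ hmax) fun t _ ht =>
    ⟨j, hj, hb, hr ▸ WithTop.coe_lt_coe.2 (hw' ▸ ht)⟩
  exact hw' ▸ (WithTop.coe_lt_coe.1 hs).le

/-- The cascade consists of the intervals in the support of `a` that outlive all younger ones. -/
theorem IsElderRule.mem_cascade_iff (h : F.IsInsertion F' σ)
    (hz : F.IsCycleDecomposition k b d fun i => (z i : Finset V →₀ 𝕜))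
    (ha : IsElderRule F F' σ k b d (fun i => (z i : Finset V →₀ 𝕜)) a) {i : ι} :
    i ∈ cascade h b (fun i => (Submodule.Quotient.mk (z i) : Homology 𝕜 (F.upTo (b i)) k)) ↔
      a i ≠ 0 ∧ ∀ j, a j ≠ 0 → b i < b j → d j < d i := by
  refine ⟨fun hi => ?_, fun ⟨hi, hlt⟩ => ?_⟩
  · by_contra hnot
    refine hi (h.killer_eq (z i) fun t hbt => ?_)
    rw [hz.mem_elder_iff hbt]
    rcases lt_or_ge (t : WithTop ℝ) (d i) with hd | hd
    · rw [ha.mem_elder_iff i t hbt hd]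
      exact iff_of_false (fun ht => hnot ⟨ht.2.1, fun j hj hbj => (ht.2.2 j hj hbj).trans_lt hd⟩)
        hd.not_ge
    · refine iff_of_true (mem_sup_of_le (cycles_mono (h.below_le _) k)
        (boundaries_mono (h.upTo_le t) k) ((hz.mem_elder_iff hbt).2 hd)) hd
  · intro heq
    by_cases hex : ∃ j, a j ≠ 0 ∧ b i < b j
    · obtain ⟨j, hj, hmax⟩ := (a.support.filter fun j => b i < b j).exists_max_image d
        (hex.imp fun j hj => by simpa using hj)
      simp only [Finset.mem_filter, Finsupp.mem_support_iff, and_imp] at hj hmax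
      have hdj := hlt j hj.1 hj.2
      obtain ⟨r, hr⟩ := WithTop.ne_top_iff_exists.1 hdj.ne_top
      obtain ⟨τ, -, hw, hkill⟩ := hz.exists_killer_eq hr.symm
      rw [ha.killer_eq_killer h hz hi hj.1 hj.2 hdj hmax, hkill] at heq
      have := (hz.death_eq_of_killer heq).2
      exact hdj.ne (hr.symm.trans (by rw [this, hw]))
    · push Not at hex
      rw [ha.killer_eq_inserted h hi hex] at heq
      exact h.notMem (hz.death_eq_of_killer heq).1

end Rule

end Filtration

end Cascade

/-! ### The cascade -/

theorem lemma6p3 {𝕜 : Type*} [Field 𝕜] {V : Type*} [LinearOrder V]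
    {F F' : Cascade.Filtration V} {σ : Finset V} (hσ : F.IsInsertion F' σ)
    (hneg : F'.IsNegative 𝕜 σ) (k : ℕ)
    {ι : Type*} (b : ι → ℝ) (d : ι → WithTop ℝ)
    (γ : ∀ i, Cascade.Homology 𝕜 (F.upTo (b i)) k)
    (hdgm : F.IsIntervalDecomposition k b d γ)
    -- an enumeration of the cascade by decreasing birth
    (m : ℕ) (c : Fin m → ι) (hc : Function.Injective c)
    (hrange : Set.range c = Cascade.Filtration.cascade hσ b γ)
    (hanti : Antitone fun j => b (c j)) :
    -- the cascade is not empty in the degree of the classes that `σ` can kill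
    (σ.card = k + 2 → 0 < m) ∧
    (∀ j, (F'.w σ : WithTop ℝ) ≤ d (c j)) ∧
    (Monotone fun j => d (c j)) ∧
    (∀ i j, i ≤ j →
      Set.Ioo (b (c i) : WithTop ℝ) (d (c i)) ⊆ Set.Ioo (b (c j) : WithTop ℝ) (d (c j))) ∧
    (∀ j : Fin m, j.val = 0 →
      F'.killer (Cascade.homologyMap (hσ.upTo_le (b (c j))) k (γ (c j))) = some σ) ∧
    (∀ i j : Fin m, j.val = i.val + 1 →
      F'.killer (Cascade.homologyMap (hσ.upTo_le (b (c j))) k (γ (c j))) =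
        F.killer (γ (c i))) := by
  choose z hzγ using fun i => Submodule.Quotient.mk_surjective _ (γ i)
  obtain rfl : (fun i => Submodule.Quotient.mk (z i)) = γ := funext hzγ
  by_cases hcard : σ.card = k + 2
  swap
  · -- in the other degrees the cascade is empty
    obtain rfl : m = 0 := by
      by_contra hm
      have h0 : c ⟨0, Nat.pos_of_ne_zero hm⟩ ∈ Cascade.Filtration.cascade hσ b _ := hrange ▸ Set.mem_range_self _
      exact h0 (hσ.killer_eq _ fun t _ => hσ.mem_elder_iff_of_card_ne hcard _ t)
    exact ⟨fun h => absurd h hcard, finZeroElim, fun i => i.elim0, finZeroElim, finZeroElim,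
      finZeroElim⟩
  have hz := hdgm.isCycleDecomposition
  obtain ⟨a, ha⟩ := hσ.exists_isElderRule hneg hcard hz
  have hC (n : Fin m) : a (c n) ≠ 0 ∧ ∀ j, a j ≠ 0 → b (c n) < b j → d j < d (c n) :=
    (ha.mem_cascade_iff hσ hz).1 (hrange ▸ Set.mem_range_self n)
  have hC' (i : ι) (hi : a i ≠ 0) (hlt : ∀ j, a j ≠ 0 → b i < b j → d j < d i) : ∃ n, c n = i := by
    have hmem := (ha.mem_cascade_iff hσ hz).2 ⟨hi, hlt⟩
    rwa [← hrange] at hmem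
  -- the youngest interval in the support belongs to the cascade
  obtain ⟨i₀, hi₀, hmax₀⟩ := a.support.exists_max_image b (Finsupp.support_nonempty_iff.2 ha.ne_zero)
  simp only [Finsupp.mem_support_iff] at hi₀ hmax₀
  obtain ⟨n₀, rfl⟩ := hC' i₀ hi₀ fun j hj hbj => absurd hbj (hmax₀ j hj).not_gt
  have hstrict {i j : Fin m} (hij : i < j) : b (c j) < b (c i) :=
    (hanti hij.le).lt_of_ne fun he => hij.ne' (hc (hz.birth_injective he))
  have hmono : Monotone fun j => d (c j) := fun i j hij => by
    rcases hij.eq_or_lt with rfl | hij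
    · exact le_rfl
    · exact ((hC j).2 _ (hC i).1 (hstrict hij)).le
  refine ⟨fun _ => n₀.pos, fun j => (ha.lt_death _ (hC j).1).le, hmono, fun i j hij =>
    Set.Ioo_subset_Ioo (WithTop.coe_le_coe.2 (hanti hij)) (hmono hij), fun j hj => ?_,
    fun i j hij => ?_⟩
  · have hjn : j ≤ n₀ := Fin.le_def.2 (by omega)
    exact ha.killer_eq_inserted hσ (hC j).1 fun l hl => (hmax₀ l hl).trans (hanti hjn)
  · have hlt := hstrict (Fin.lt_def.2 (by omega) : i < j)
    refine ha.killer_eq_killer hσ hz (hC j).1 (hC i).1 hlt ((hC j).2 _ (hC i).1 hlt) ?_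
    -- the longest living interval younger than `c j`, the youngest if there are several, belongs
    -- to the cascade
    obtain ⟨l, hl, hmax⟩ := (a.support.filter fun l => b (c j) < b l).exists_max_image
      (fun l => toLex (d l, b l)) ⟨c i, by simpa using ⟨(hC i).1, hlt⟩⟩
    simp only [Finset.mem_filter, Finsupp.mem_support_iff, and_imp, Prod.Lex.toLex_le_toLex]
      at hl hmax
    obtain ⟨n, rfl⟩ := hC' l hl.1 fun l' hl' hb =>
      (hmax l' hl' (hl.2.trans hb)).resolve_right fun h => h.2.not_gt hb
    have hnj : n < j := not_le.1 fun hjn => (hanti hjn).not_gt hl.2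
    have hni : n ≤ i := Fin.le_def.2 (by rw [Fin.lt_def] at hnj; omega)
    exact fun l' hl' hb => ((hmax l' hl' hb).elim le_of_lt fun h => h.1.le).trans (hmono hni)
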